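/- Let $F$ be a field of characteristic $0$ (for instance $F=\mathbb{Q}$ or $F=\mathbb{Q}(q)$), let $K=F(t)$ with $t$ an indeterminate, and let $\Lambda=K[p_1,p_2,\dots]$ be the ring of symmetric functions over $K$ in infinitely many variables $X=x_1+x_2+\cdots$, where $p_n$ is the $n$-th power sum. Let $h_r,e_r$ be the complete and elementary symmetric functions and let $s_\lambda=\det\bigl(h_{\lambda_i+j-i}\bigr)_{1\le i,j\le\ell(\lambda)}$ be the Schur function of the partition $\lambda$. For $f\in\Lambda$ let $f[X/(1-t)]$ be the image of $f$ under the $K$-algebra homomorphism $p_n\mapsto p_n/(1-t^n)$. Let $H_\lambda[X;t]=Q_\lambda[X/(1-t);t]$ be the modified Hall–Littlewood functions. Here $(Q_\lambda[X;t])_\lambda$ is the Hall–Littlewood family, i.e. the Macdonald integral forms $J_\lambda[X;q,t]$ at $q=0$, characterized as follows: the $Q_\lambda$ are pairwise orthogonal for the scalar product $$\langle p_\lambda,p_\mu\rangle=\delta_{\lambda\mu}\,z_\lambda\prod_{i=1}^{\ell(\lambda)}\frac{1}{1-t^{\lambda_i}},\qquad z_\lambda=\prod_{i\ge1} i^{m_i(\lambda)}\,m_i(\lambda)!,$$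 where $m_i(\lambda)$ is the number of parts of $\lambda$ equal to $i$, and $Q_\lambda\in v_\lambda s_\lambda+\sum_{\mu<\lambda}K s_\mu$, where $<$ is the strict dominance order and $v_\lambda=\prod_{s}(1-t^{\ell(s)+1})$, the product being over the cells $s$ of $\lambda$ with arm length $a(s)=0$, and $\ell(s)$ being the leg length. For an integer $k\ge 0$ let $\Lambda^{(k)}_t\subseteq\Lambda$ be the $K$-linear span of the $H_\lambda[X;t]$ over all partitions $\lambda$ with $\lambda_1\le k$. Let $\omega$ be the $K$-algebra endomorphism of $\Lambda$ with $\omega(h_r)=e_r$ for all $r$ (so $\omega(p_n)=(-1)^{n-1}p_n$), and for $f\in\Lambda$ let $\omega_t f=(\omega f)\big|_{t\to 1/t}$, where the substitution $t\to1/t$ is applied to the coefficients in $F(t)$ of $\omega f$, written as a polynomial in the power sums. **Proposition.** If $f\in\Lambda^{(k)}_t$, then $\omega_t f\in\Lambda^{(k)}_t$. Moreover, for every partition $\lambda$, $$\omega_t\, s_\lambda[X/(1-t)]=(-t)^{|\lambda|}\,s_\lambda[X/(1-t)].$$ -/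

import Mathlib

open scoped BigOperators

noncomputable section

namespace SymmFun

/-! ### Partitions, written as Young diagrams

The parts of `lam` are `lam.rowLen 0 ≥ lam.rowLen 1 ≥ …`, its length is `lam.colLen 0` and its
degree is `lam.card`. -/

/-- Dominance order: `|μ| = |lam|` and `μ_1 + ⋯ + μ_r ≤ lam_1 + ⋯ + lam_r` for all `r`. -/
def Dominated (mu lam : YoungDiagram) : Prop :=
  mu.card = lam.card ∧
    ∀ r : ℕ, ∑ i ∈ Finset.range r, mu.rowLen i ≤ ∑ i ∈ Finset.range r, lam.rowLen i

theorem Dominated.trans {a b c : YoungDiagram} (h₁ : Dominated a b) (h₂ : Dominated b c) :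
    Dominated a c :=
  ⟨h₁.1.trans h₂.1, fun r => (h₁.2 r).trans (h₂.2 r)⟩

theorem Dominated.antisymm {a b : YoungDiagram} (h₁ : Dominated a b) (h₂ : Dominated b a) :
    a = b := by
  have hs : ∀ r, ∑ i ∈ Finset.range r, a.rowLen i = ∑ i ∈ Finset.range r, b.rowLen i :=
    fun r => le_antisymm (h₁.2 r) (h₂.2 r)
  have hr : ∀ i, a.rowLen i = b.rowLen i := by
    intro i
    have h := hs (i + 1)
    rw [Finset.sum_range_succ, Finset.sum_range_succ, hs i] at h
    exact Nat.add_left_cancel h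
  apply SetLike.ext
  rintro ⟨i, j⟩
  rw [YoungDiagram.mem_iff_lt_rowLen, YoungDiagram.mem_iff_lt_rowLen, hr]

theorem finite_card_eq (n : ℕ) : {mu : YoungDiagram | mu.card = n}.Finite := by
  have hinj : Function.Injective (fun mu : YoungDiagram => mu.cells) := by
    intro a b h
    exact YoungDiagram.ext h
  refine Set.Finite.of_finite_image (f := fun mu : YoungDiagram => mu.cells) ?_ hinj.injOn
  refine Set.Finite.subset
    (Finset.finite_toSet (Finset.range n ×ˢ Finset.range n).powerset) ?_
  rintro _ ⟨mu, hmu, rfl⟩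
  simp only [Set.mem_ofPred_eq] at hmu
  simp only [Finset.coe_powerset, Set.mem_preimage, Set.mem_powerset_iff, Finset.coe_subset]
  rintro ⟨i, j⟩ hij
  rw [YoungDiagram.mem_cells] at hij
  have h1 : mu.colLen j ≤ n := by
    rw [YoungDiagram.colLen_eq_card, ← hmu]
    exact Finset.card_le_card (Finset.filter_subset _ _)
  have h2 : mu.rowLen i ≤ n := by
    rw [YoungDiagram.rowLen_eq_card, ← hmu]
    exact Finset.card_le_card (Finset.filter_subset _ _)
  have h3 := YoungDiagram.mem_iff_lt_colLen.1 hij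
  have h4 := YoungDiagram.mem_iff_lt_rowLen.1 hij
  simp only [Finset.mem_product, Finset.mem_range]
  omega

open Classical in
/-- The finite set of all partitions `μ < lam` in dominance order. -/
def below (lam : YoungDiagram) : Finset YoungDiagram :=
  (finite_card_eq lam.card).toFinset.filter fun mu => Dominated mu lam ∧ mu ≠ lam

theorem mem_below {mu lam : YoungDiagram} : mu ∈ below lam ↔ Dominated mu lam ∧ mu ≠ lam := by
  classical
  simp only [below, Finset.mem_filter, Set.Finite.mem_toFinset, Set.mem_ofPred_eq]
  exact ⟨fun h => h.2, fun h => ⟨h.1.1, h⟩⟩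

theorem card_below_lt {mu lam : YoungDiagram} (h : mu ∈ below lam) :
    (below mu).card < (below lam).card := by
  refine Finset.card_lt_card ((Finset.ssubset_iff_of_subset ?_).2 ⟨mu, h, ?_⟩)
  · intro nu hnu
    rw [mem_below] at *
    refine ⟨hnu.1.trans h.1, ?_⟩
    rintro rfl
    exact h.2 (h.1.antisymm hnu.1)
  · intro h'
    exact (mem_below.1 h').2 rfl

/-- The arm of the cell `s = (i, j)` (row `i`, column `j`, counted from `0`): the number of cells
of `lam` in the same row beyond `s`. -/
def arm (lam : YoungDiagram) (s : ℕ × ℕ) : ℕ := lam.rowLen s.1 - (s.2 + 1)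

/-- The leg of the cell `s = (i, j)`: the number of cells of `lam` in the same column beyond
`s`. -/
def leg (lam : YoungDiagram) (s : ℕ × ℕ) : ℕ := lam.colLen s.2 - (s.1 + 1)

/-! ### Symmetric functions -/

/-- The ring of symmetric functions over a field `K` of characteristic zero, presented as the
polynomial ring in the power sums `p_1, p_2, …` (in infinitely many variables `x_1, x_2, …` the
power sums are algebraically independent and generate). -/
abbrev Lam (K : Type*) [Field K] : Type _ := MvPolynomial ℕ+ K

section Basic

variable {K : Type*} [Field K]

/-- The power sum `p_n`, `n ≥ 1`. -/
def p (K : Type*) [Field K] (n : ℕ+) : Lam K := MvPolynomial.X n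

/-- The complete symmetric functions `h_n`, in terms of power sums:
`h_0 = 1` and `n h_n = ∑_{i = 1}^{n} p_i h_{n-i}`. -/
def h (K : Type*) [Field K] : ℕ → Lam K
  | 0 => 1
  | n + 1 => ((n + 1 : ℕ) : K)⁻¹ • ∑ i : Fin (n + 1), p K (Nat.succPNat i) * h K (n - i)

/-- The elementary symmetric functions `e_n`, in terms of power sums:
`e_0 = 1` and `n e_n = ∑_{i = 1}^{n} (-1)^{i-1} p_i e_{n-i}`. -/
def e (K : Type*) [Field K] : ℕ → Lam K
  | 0 => 1
  | n + 1 => ((n + 1 : ℕ) : K)⁻¹ •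
      ∑ i : Fin (n + 1), (-1) ^ (i : ℕ) * p K (Nat.succPNat i) * e K (n - i)

/-- `h_r` for an integer index, with `h_r = 0` for `r < 0`. -/
def hInt (K : Type*) [Field K] (r : ℤ) : Lam K := if 0 ≤ r then h K r.toNat else 0

/-- The Schur function `s_lam = det (h_{lam_i + j - i})`, `1 ≤ i, j ≤ ℓ(lam)`. -/
def schur (K : Type*) [Field K] (lam : YoungDiagram) : Lam K :=
  Matrix.det (Matrix.of fun i j : Fin (lam.colLen 0) =>
    hInt K ((lam.rowLen i : ℤ) + (j : ℤ) - (i : ℤ)))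

/-- The `K`-algebra endomorphism `ω`, on power sums `ω p_n = (-1)^{n-1} p_n`; it is characterized
by `ω h_r = e_r`, see `omega_h`. -/
def omega (K : Type*) [Field K] : Lam K →ₐ[K] Lam K :=
  MvPolynomial.aeval fun n : ℕ+ => (-1) ^ ((n : ℕ) - 1) * p K n

theorem omega_h (r : ℕ) : omega K (h K r) = e K r := by
  induction r using Nat.strong_induction_on with
  | _ r ih =>
    cases r with
    | zero => rw [h, e, map_one]
    | succ n =>
      rw [h, e, map_smul, map_sum]
      congr 1
      refine Finset.sum_congr rfl fun i _ => ?_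
      rw [map_mul, ih (n - i) (by omega)]
      simp [omega, p]

/-- The plethystic substitution `f[X] ↦ f[X/(1-t)]`: the `K`-algebra endomorphism with
`p_n ↦ p_n / (1 - t^n)`. -/
def plethysm (t : K) : Lam K →ₐ[K] Lam K :=
  MvPolynomial.aeval fun n : ℕ+ => (1 - t ^ (n : ℕ))⁻¹ • p K n

/-- `z_lam ∏_i (1 - q^{lam_i}) / (1 - t^{lam_i})` for the partition `lam` with `m i` parts equal
to `i`, where `z_lam = ∏_i i^{m i} (m i)!`. -/
def weight (q t : K) (m : ℕ+ →₀ ℕ) : K :=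
  m.prod fun i a => ((i : ℕ) : K) ^ a * (a.factorial : K) *
    ((1 - q ^ (i : ℕ)) / (1 - t ^ (i : ℕ))) ^ a

/-- The Macdonald scalar product: the bilinear form with
`⟨p_lam, p_mu⟩_{q,t} = δ_{lam mu} z_lam ∏_i (1 - q^{lam_i}) / (1 - t^{lam_i})`; the coefficient
of `p_lam` in `f` is `f.coeff m`, where `m i` is the number of parts of `lam` equal to `i`. -/
def scalar (q t : K) (f g : Lam K) : K :=
  ∑ m ∈ f.support, f.coeff m * g.coeff m * weight q t m

/-- The Macdonald polynomial normalized by having coefficient `1` at `s_lam`, by Gram-Schmidt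
orthogonalization of the Schur functions along the dominance order:
`P_lam = s_lam - ∑_{mu < lam} (⟨s_lam, P_mu⟩_{q,t} / ⟨P_mu, P_mu⟩_{q,t}) P_mu`. -/
def macdonaldP (q t : K) (lam : YoungDiagram) : Lam K :=
  schur K lam - ∑ mu : {mu // mu ∈ below lam},
    (scalar q t (schur K lam) (macdonaldP q t mu.1) /
      scalar q t (macdonaldP q t mu.1) (macdonaldP q t mu.1)) • macdonaldP q t mu.1
termination_by (below lam).card
decreasing_by all_goals exact card_below_lt mu.2

/-- `v_{lam lam}(q,t) = ∏_{s ∈ lam} (1 - q^{a(s)} t^{ℓ(s)+1})`. -/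
def leadingCoeff (q t : K) (lam : YoungDiagram) : K :=
  ∏ s ∈ lam.cells, (1 - q ^ arm lam s * t ^ (leg lam s + 1))

/-- The Macdonald integral form `J_lam[X;q,t]`, see `IsMacdonald.unique`. For `q = 0` it is the
Hall-Littlewood polynomial `Q_lam[X;t]`. -/
def macdonaldJ (q t : K) (lam : YoungDiagram) : Lam K :=
  leadingCoeff q t lam • macdonaldP q t lam

/-- The modified Macdonald polynomial `H_lam[X;q,t] = J_lam[X/(1-t);q,t]`. -/
def macdonaldH (q t : K) (lam : YoungDiagram) : Lam K :=
  plethysm t (macdonaldJ q t lam)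

/-- The modified Hall-Littlewood polynomial `H_lam[X;t] = H_lam[X;0,t] = Q_lam[X/(1-t);t]`. -/
def hallLittlewoodH (t : K) (lam : YoungDiagram) : Lam K :=
  macdonaldH 0 t lam

/-- `Λ^{(k)}_t`, the linear span of the `H_lam[X;t]` with `lam_1 ≤ k`. -/
def lamK (t : K) (k : ℕ) : Submodule K (Lam K) :=
  Submodule.span K {f | ∃ lam : YoungDiagram, lam.rowLen 0 ≤ k ∧ f = hallLittlewoodH t lam}

/-- The defining properties of the Macdonald integral forms: orthogonality, triangularity with
respect to the dominance order on Schur functions, and the coefficient of `s_lam`. -/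
structure IsMacdonald (q t : K) (J : YoungDiagram → Lam K) : Prop where
  orthogonal : ∀ lam mu, lam ≠ mu → scalar q t (J lam) (J mu) = 0
  triangular : ∀ lam, J lam - leadingCoeff q t lam • schur K lam ∈
    Submodule.span K (schur K '' {mu | mu ∈ below lam})

theorem scalar_eq_sum (q t : K) (f g : Lam K) (s : Finset (ℕ+ →₀ ℕ)) (hs : f.support ⊆ s) :
    scalar q t f g = ∑ m ∈ s, f.coeff m * g.coeff m * weight q t m := by
  refine Finset.sum_subset hs fun m _ hm => ?_
  rw [MvPolynomial.notMem_support_iff.1 hm, zero_mul, zero_mul]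

theorem scalar_add_left (q t : K) (f f' g : Lam K) :
    scalar q t (f + f') g = scalar q t f g + scalar q t f' g := by
  classical
  rw [scalar_eq_sum q t (f + f') g (f.support ∪ f'.support) MvPolynomial.support_add,
    scalar_eq_sum q t f g _ Finset.subset_union_left,
    scalar_eq_sum q t f' g _ Finset.subset_union_right, ← Finset.sum_add_distrib]
  refine Finset.sum_congr rfl fun m _ => ?_
  rw [MvPolynomial.coeff_add]
  ring

theorem scalar_smul_left (q t c : K) (f g : Lam K) :
    scalar q t (c • f) g = c * scalar q t f g := by
  rw [scalar_eq_sum q t (c • f) g f.support MvPolynomial.support_smul, scalar, Finset.mul_sum]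
  refine Finset.sum_congr rfl fun m _ => ?_
  rw [MvPolynomial.coeff_smul, smul_eq_mul]
  ring

theorem scalar_comm (q t : K) (f g : Lam K) : scalar q t f g = scalar q t g f := by
  classical
  rw [scalar_eq_sum q t f g (f.support ∪ g.support) Finset.subset_union_left,
    scalar_eq_sum q t g f (f.support ∪ g.support) Finset.subset_union_right]
  exact Finset.sum_congr rfl fun m _ => by ring

/-- A family with the defining properties of the Macdonald integral forms, with nonzero norms, is
the family constructed above. -/
theorem IsMacdonald.unique (q t : K) (J : YoungDiagram → Lam K) (hJ : IsMacdonald q t J)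
    (hlead : ∀ lam, leadingCoeff q t lam ≠ 0) (hnorm : ∀ lam, scalar q t (J lam) (J lam) ≠ 0) :
    J = macdonaldJ q t := by
  classical
  have hspan : ∀ n, ∀ lam, (below lam).card = n →
      Submodule.span K (schur K '' {mu | mu ∈ below lam}) ≤
        Submodule.span K (J '' {mu | mu ∈ below lam}) := by
    intro n
    induction n using Nat.strong_induction_on with
    | _ n ih =>
      rintro lam rfl
      rw [Submodule.span_le]
      rintro _ ⟨mu, hmu, rfl⟩
      have hmu' : mu ∈ below lam := hmu
      have hsub : Submodule.span K (J '' {nu | nu ∈ below mu}) ≤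
          Submodule.span K (J '' {nu | nu ∈ below lam}) := by
        refine Submodule.span_mono (Set.image_mono fun nu hnu => ?_)
        have h1 := mem_below.1 (show nu ∈ below mu from hnu)
        have h2 := mem_below.1 hmu'
        refine mem_below.2 ⟨h1.1.trans h2.1, ?_⟩
        rintro rfl
        exact h2.2 (h2.1.antisymm h1.1)
      have h1 := hsub (ih _ (card_below_lt hmu') mu rfl (hJ.triangular mu))
      have h2 : J mu ∈ Submodule.span K (J '' {nu | nu ∈ below lam}) :=
        Submodule.subset_span ⟨mu, hmu, rfl⟩
      have h3 := Submodule.smul_mem _ (leadingCoeff q t mu)⁻¹ (Submodule.sub_mem _ h2 h1)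
      rw [sub_sub_cancel, smul_smul, inv_mul_cancel₀ (hlead mu), one_smul] at h3
      exact h3
  have hmain : ∀ n, ∀ lam, (below lam).card = n → J lam = macdonaldJ q t lam := by
    intro n
    induction n using Nat.strong_induction_on with
    | _ n ih =>
      rintro lam rfl
      have h1 := hspan _ lam rfl (hJ.triangular lam)
      have h2 : {mu | mu ∈ below lam} = (below lam : Set YoungDiagram) := rfl
      rw [h2, Submodule.mem_span_image_finset_iff_exists_fun'] at h1
      obtain ⟨c, hc⟩ := h1
      have hexp : J lam = leadingCoeff q t lam • schur K lam + ∑ mu ∈ below lam, c mu • J mu := by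
        rw [hc]; abel
      have hsum : ∀ (s : Finset YoungDiagram) (g : Lam K),
          scalar q t (∑ mu ∈ s, c mu • J mu) g = ∑ mu ∈ s, c mu * scalar q t (J mu) g := by
        intro s g
        induction s using Finset.induction_on with
        | empty => simp [scalar]
        | insert a s ha ihs =>
          rw [Finset.sum_insert ha, Finset.sum_insert ha, scalar_add_left, scalar_smul_left, ihs]
      rw [macdonaldJ, macdonaldP, smul_sub, hexp, sub_eq_add_neg]
      congr 1
      rw [← Finset.sum_coe_sort, Finset.smul_sum, ← Finset.sum_neg_distrib]
      refine Finset.sum_congr rfl fun nu _ => ?_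
      obtain ⟨nu, hnu⟩ := nu
      have h0 := hJ.orthogonal lam nu (mem_below.1 hnu).2.symm
      rw [hexp, scalar_add_left, scalar_smul_left, hsum,
        Finset.sum_eq_single_of_mem nu hnu
          (fun b _ hb => by rw [hJ.orthogonal b nu hb, mul_zero])] at h0
      have hn := hnorm nu
      have hP := ih _ (card_below_lt hnu) nu rfl
      rw [macdonaldJ] at hP
      have hl := hlead nu
      dsimp only
      rw [hP, scalar_smul_left, scalar_comm q t (macdonaldP q t nu), scalar_smul_left] at h0 hn
      rw [scalar_comm q t (schur K lam), scalar_smul_left,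
        scalar_comm q t (macdonaldP q t nu) (schur K lam)] at h0
      have hn' : scalar q t (macdonaldP q t nu) (macdonaldP q t nu) ≠ 0 := by
        intro h; apply hn; rw [h, mul_zero, mul_zero]
      rw [hP, smul_smul, smul_smul, ← neg_smul]
      congr 1
      field_simp
      have h0' : leadingCoeff q t nu * (leadingCoeff q t lam *
          scalar q t (schur K lam) (macdonaldP q t nu) + c nu * leadingCoeff q t nu *
          scalar q t (macdonaldP q t nu) (macdonaldP q t nu)) = 0 := by
        rw [← h0]; ring
      have h0'' := (mul_eq_zero.1 h0').resolve_left hl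
      linear_combination h0''
  funext lam
  exact hmain _ lam rfl

end Basic

/-! ### Coefficients in `F(t)` and the twisted involution -/

section Twist

variable (F : Type*) [Field F]

/-- The field `F(t)` of rational functions in `t`. -/
abbrev Coeff : Type _ := RatFunc F

/-- The parameter `t`. -/
def t : Coeff F := RatFunc.X

theorem transcendental_t_inv : Transcendental F (t F)⁻¹ := by
  intro hal
  have := hal.inv
  rw [inv_inv] at this
  exact RatFunc.transcendental_X this

/-- The substitution `t → 1/t` on `F(t)`, fixing `F`. -/
def invT : Coeff F →ₐ[F] Coeff F :=
  RatFunc.liftAlgHom (Polynomial.aeval (t F)⁻¹)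
    (nonZeroDivisors_le_comap_nonZeroDivisors_of_injective _
      (transcendental_iff_injective.1 (transcendental_t_inv F)))

theorem invT_t : invT F (t F) = (t F)⁻¹ := by
  have hx : t F = algebraMap (Polynomial F) (RatFunc F) Polynomial.X := by
    rw [RatFunc.algebraMap_X, t]
  have := RatFunc.liftAlgHom_apply_div' (L := Coeff F) (Polynomial.aeval (t F)⁻¹)
    (nonZeroDivisors_le_comap_nonZeroDivisors_of_injective _
      (transcendental_iff_injective.1 (transcendental_t_inv F))) Polynomial.X 1
  simpa [invT, ← hx] using this

/-- `ω_t f = (ω f)|_{t → 1/t}`, where the substitution acts on the coefficients of `ω f`. -/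
def omegaT : Lam (Coeff F) →+* Lam (Coeff F) :=
  (MvPolynomial.map (invT F).toRingHom).comp (omega (Coeff F)).toRingHom

end Twist

end SymmFun

end

noncomputable section

namespace SymmFun

/-! On the generators, `ω_t` multiplies `p_n/(1-t^n)` by `(-t)^n`, because `(-1)^(n-1)/(1-t^(-n)) =
(-t)^n/(1-t^n)` (`omegaT_plethysm_p`). Hence `ω_t` scales the plethysm of a homogeneous function of
degree `d` with rational coefficients by `(-t)^d`. Schur functions are such functions
(`map_schur_of_map_p`), which is the second claim.

For the first claim, the transition between `Q_lam` and `s_lam` is triangular in dominance order,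
and dominance can only lower the first part. So `Λ^{(k)}_t` is also spanned by the eigenvectors
`s_lam[X/(1-t)]` with `lam_1 ≤ k` (`lamK_eq_map_schurSpan`). Orthogonality plays no role, only
triangularity and a nonzero leading coefficient. -/

theorem sum_rowLen (lam : YoungDiagram) :
    ∑ i : Fin (lam.colLen 0), lam.rowLen i = lam.card := by
  have hmaps : ∀ c ∈ lam.cells, c.1 ∈ Finset.range (lam.colLen 0) := by
    rintro ⟨i, j⟩ hc
    rw [Finset.mem_range, ← YoungDiagram.mem_iff_lt_colLen]
    exact lam.up_left_mem le_rfl (Nat.zero_le j) ((YoungDiagram.mem_cells _).1 hc)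
  rw [Fin.sum_univ_eq_sum_range (fun i => lam.rowLen i), YoungDiagram.card,
    Finset.card_eq_sum_card_fiberwise hmaps]
  refine Finset.sum_congr rfl fun i _ => ?_
  rw [YoungDiagram.rowLen_eq_card, YoungDiagram.row]

theorem Dominated.rowLen_zero_le {mu lam : YoungDiagram} (hd : Dominated mu lam) :
    mu.rowLen 0 ≤ lam.rowLen 0 := by
  simpa using hd.2 1

/-! ### Homogeneity of `h_r` and `s_lam` under rescaling of the power sums -/

section Scaling

variable {K : Type*} [Field K]

/-- Two ring homomorphisms that differ on `p_n` by the factor `c ^ n` differ on `h_n` by the same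
factor. -/
theorem map_h_of_map_p {S : Type*} [CommRing S] (φ ψ : Lam K →+* S) (c : S)
    (hp : ∀ n : ℕ+, φ (p K n) = c ^ (n : ℕ) * ψ (p K n))
    (hC : ∀ n : ℕ, φ (MvPolynomial.C ((n : K)⁻¹)) = ψ (MvPolynomial.C ((n : K)⁻¹))) (r : ℕ) :
    φ (h K r) = c ^ r * ψ (h K r) := by
  induction r using Nat.strong_induction_on with
  | _ r ih =>
    cases r with
    | zero => rw [h, map_one, map_one, pow_zero, one_mul]
    | succ n =>
      -- The maps need not be `K`-linear, since `ω_t` is not: the only scalars in the recursion for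
      -- `h` are inverses of integers.
      rw [h, MvPolynomial.smul_eq_C_mul, map_mul, map_mul, hC, mul_left_comm]
      congr 1
      rw [map_sum, map_sum, Finset.mul_sum]
      refine Finset.sum_congr rfl fun i _ => ?_
      have hpow : c ^ (n + 1) = c ^ ((i : ℕ) + 1) * c ^ (n - (i : ℕ)) := by
        rw [← pow_add]
        congr 1
        omega
      rw [map_mul, map_mul, ih (n - i) (by omega), hp, hpow, Nat.succPNat_coe,
        Nat.succ_eq_add_one]
      ring

/-- The Schur function `s_lam` is homogeneous of degree `|lam|`. -/
theorem map_schur_of_map_p {c : K} (hc : c ≠ 0) (φ ψ : Lam K →+* Lam K)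
    (hp : ∀ n : ℕ+, φ (p K n) = MvPolynomial.C c ^ (n : ℕ) * ψ (p K n))
    (hC : ∀ n : ℕ, φ (MvPolynomial.C ((n : K)⁻¹)) = ψ (MvPolynomial.C ((n : K)⁻¹)))
    (lam : YoungDiagram) :
    φ (schur K lam) = c ^ lam.card • ψ (schur K lam) := by
  have hInt_map : ∀ r : ℤ, φ (hInt K r) = MvPolynomial.C (c ^ r) * ψ (hInt K r) := by
    intro r
    by_cases hr : 0 ≤ r
    · obtain ⟨m, rfl⟩ := Int.eq_ofNat_of_zero_le hr
      rw [hInt, if_pos hr, Int.toNat_natCast, map_h_of_map_p φ ψ _ hp hC, zpow_natCast, map_pow]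
    · rw [hInt, if_neg hr, map_zero, map_zero, mul_zero]
  let n := lam.colLen 0
  let A : Matrix (Fin n) (Fin n) (Lam K) :=
    Matrix.of fun i j => ψ (hInt K ((lam.rowLen i : ℤ) + (j : ℤ) - (i : ℤ)))
  have hψ : ψ (schur K lam) = A.det := by
    rw [schur, RingHom.map_det]
    rfl
  -- The factor `c^(lam_i + j - i)` of each entry splits into a row factor `c^(lam_i - i)` and a
  -- column factor `c^j`. Exponents may be negative, hence `zpow` and `c ≠ 0`.
  have hφ : φ (schur K lam) = (Matrix.of fun i j : Fin n =>
      (MvPolynomial.C (c ^ ((lam.rowLen i : ℤ) - (i : ℤ))) : Lam K) *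
        (Matrix.of fun i j : Fin n => (MvPolynomial.C (c ^ (j : ℤ)) : Lam K) * A i j) i j).det := by
    rw [schur, RingHom.map_det]
    congr 1
    ext1 i j
    simp only [RingHom.mapMatrix_apply, Matrix.map_apply, Matrix.of_apply, A]
    rw [hInt_map, ← mul_assoc, ← map_mul, ← zpow_add₀ hc]
    congr 3
    ring
  -- Pairing row `i` with column `i` cancels the shifts and leaves `∏ c^(lam_i) = c^|lam|`.
  rw [hφ, Matrix.det_mul_column, Matrix.det_mul_row, ← hψ, ← mul_assoc, ← Finset.prod_mul_distrib,
    MvPolynomial.smul_eq_C_mul, ← sum_rowLen lam, ← Finset.prod_pow_eq_pow_sum, map_prod]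
  congr 1
  refine Finset.prod_congr rfl fun i _ => ?_
  rw [← map_mul, ← zpow_add₀ hc, sub_add_cancel, zpow_natCast]

end Scaling

/-! ### Triangularity and the Schur description of `Λ^{(k)}_t` -/

section Triangularity

variable {K : Type*} [Field K]

/-- The span of the Schur functions `s_lam` with `lam_1 ≤ k`. -/
def schurSpan (K : Type*) [Field K] (k : ℕ) : Submodule K (Lam K) :=
  Submodule.span K (schur K '' {lam | lam.rowLen 0 ≤ k})

theorem macdonaldP_mem_schurSpan (q t : K) {k : ℕ} (lam : YoungDiagram) (hk : lam.rowLen 0 ≤ k) :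
    macdonaldP q t lam ∈ schurSpan K k := by
  rw [macdonaldP]
  refine Submodule.sub_mem _ (Submodule.subset_span ⟨lam, hk, rfl⟩)
    (Submodule.sum_mem _ fun mu _ => Submodule.smul_mem _ _ ?_)
  exact macdonaldP_mem_schurSpan q t mu.1 ((mem_below.1 mu.2).1.rowLen_zero_le.trans hk)
termination_by (below lam).card
decreasing_by exact card_below_lt mu.2

/-- The Gram-Schmidt recursion, solved for `s_lam`, already expresses it through `P_lam` and lower
`P_mu`, so no induction is needed. -/
theorem schur_mem_span_macdonaldP (q t : K) {k : ℕ} (lam : YoungDiagram)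
    (hk : lam.rowLen 0 ≤ k) :
    schur K lam ∈ Submodule.span K (macdonaldP q t '' {lam | lam.rowLen 0 ≤ k}) := by
  have hP := macdonaldP.eq_1 q t lam
  rw [eq_sub_iff_add_eq] at hP
  rw [← hP]
  refine Submodule.add_mem _ (Submodule.subset_span ⟨lam, hk, rfl⟩)
    (Submodule.sum_mem _ fun mu _ => Submodule.smul_mem _ _ (Submodule.subset_span ⟨mu.1, ?_, rfl⟩))
  exact (mem_below.1 mu.2).1.rowLen_zero_le.trans hk

/-- `Λ^{(k)}_t` is the span of the `s_lam[X/(1-t)]` with `lam_1 ≤ k`. -/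
theorem lamK_eq_map_schurSpan {t : K} (ht : ∀ n : ℕ, t ^ (n + 1) ≠ 1) (k : ℕ) :
    lamK t k = (schurSpan K k).map (plethysm t).toLinearMap := by
  -- At `q = 0` a cell with arm `0` contributes `1 - t^(ℓ+1)`, as `0^0 = 1`, and every other cell
  -- contributes `1`.
  have hlead : ∀ lam, leadingCoeff 0 t lam ≠ 0 := by
    intro lam
    refine Finset.prod_ne_zero_iff.2 fun s _ => ?_
    rcases Nat.eq_zero_or_pos (arm lam s) with h0 | h0
    · rw [h0, pow_zero, one_mul]
      exact sub_ne_zero.2 (ht _).symm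
    · rw [zero_pow h0.ne', zero_mul, sub_zero]
      exact one_ne_zero
  have hH : ∀ lam, hallLittlewoodH t lam =
      leadingCoeff 0 t lam • plethysm t (macdonaldP 0 t lam) := fun lam => map_smul _ _ _
  apply le_antisymm
  · refine Submodule.span_le.2 ?_
    rintro _ ⟨lam, hk, rfl⟩
    rw [hH]
    exact Submodule.smul_mem _ _
      (Submodule.mem_map_of_mem (macdonaldP_mem_schurSpan 0 t lam hk))
  · have hle : schurSpan K k ≤ Submodule.span K (macdonaldP 0 t '' {lam | lam.rowLen 0 ≤ k}) := by
      refine Submodule.span_le.2 ?_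
      rintro _ ⟨lam, hk, rfl⟩
      exact schur_mem_span_macdonaldP 0 t lam hk
    refine (Submodule.map_mono hle).trans ?_
    rw [Submodule.map_span, Submodule.span_le]
    rintro _ ⟨_, ⟨lam, hk, rfl⟩, rfl⟩
    have hmem := Submodule.smul_mem (lamK t k) (leadingCoeff 0 t lam)⁻¹
      (Submodule.subset_span ⟨lam, hk, rfl⟩)
    rwa [hH, smul_smul, inv_mul_cancel₀ (hlead lam), one_smul] at hmem

end Triangularity

/-! ### The action of `ω_t` -/

section Twist

variable {F : Type*} [Field F]

theorem t_pow_succ_ne_one (n : ℕ) : t F ^ (n + 1) ≠ 1 := by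
  intro h1
  refine RatFunc.transcendental_X (K := F)
    ⟨Polynomial.X ^ (n + 1) - 1, Polynomial.X_pow_sub_C_ne_zero n.succ_pos 1, ?_⟩
  simpa [t, sub_eq_zero] using h1

theorem omegaT_C (a : Coeff F) :
    omegaT F (MvPolynomial.C a) = MvPolynomial.C (invT F a) := by
  simp [omegaT]

theorem omegaT_smul (a : Coeff F) (f : Lam (Coeff F)) :
    omegaT F (a • f) = invT F a • omegaT F f := by
  rw [MvPolynomial.smul_eq_C_mul, map_mul, omegaT_C, MvPolynomial.smul_eq_C_mul]

theorem plethysm_p {K : Type*} [Field K] (t : K) (n : ℕ+) :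
    plethysm t (p K n) = MvPolynomial.C (1 - t ^ (n : ℕ))⁻¹ * p K n := by
  rw [← MvPolynomial.smul_eq_C_mul]
  exact MvPolynomial.aeval_X _ _

theorem omegaT_p (n : ℕ+) : omegaT F (p (Coeff F) n) =
    MvPolynomial.C ((-1) ^ ((n : ℕ) - 1)) * p (Coeff F) n := by
  simp [omegaT, omega, p]

/-- `ω_t` multiplies `p_n/(1-t^n)` by `(-t)^n`. -/
theorem omegaT_plethysm_p (n : ℕ+) : omegaT F (plethysm (t F) (p (Coeff F) n)) =
    MvPolynomial.C (-t F) ^ (n : ℕ) * plethysm (t F) (p (Coeff F) n) := by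
  rw [plethysm_p, map_mul, omegaT_C, omegaT_p, ← mul_assoc, ← mul_assoc, ← map_mul, ← map_pow,
    ← map_mul]
  congr 2
  obtain ⟨m, hm⟩ : ∃ m, (n : ℕ) = m + 1 := ⟨(n : ℕ) - 1, (Nat.succ_pred_eq_of_pos n.pos).symm⟩
  have ht0 : t F ≠ 0 := RatFunc.X_ne_zero
  have hinv : 1 - (t F)⁻¹ ^ (m + 1) = (t F ^ (m + 1) - 1) / t F ^ (m + 1) := by
    rw [inv_pow, sub_div, div_self (pow_ne_zero _ ht0), one_div]
  rw [hm, map_inv₀, map_sub, map_one, map_pow, invT_t, hinv, Nat.add_sub_cancel, inv_div,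
    neg_pow (t F), ← neg_sub (t F ^ (m + 1)) 1, inv_neg]
  ring

theorem omegaT_plethysm_schur (lam : YoungDiagram) :
    omegaT F (plethysm (t F) (schur (Coeff F) lam)) =
      (-t F) ^ lam.card • plethysm (t F) (schur (Coeff F) lam) := by
  refine map_schur_of_map_p (neg_ne_zero.2 RatFunc.X_ne_zero)
    ((omegaT F).comp (plethysm (t F)).toRingHom) (plethysm (t F)).toRingHom
    omegaT_plethysm_p (fun n => ?_) lam
  have hC : ∀ a : Coeff F, plethysm (t F) (MvPolynomial.C a) = MvPolynomial.C a :=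
    fun a => MvPolynomial.aeval_C _ a
  change omegaT F (plethysm (t F) _) = plethysm (t F) _
  -- The scalars `n⁻¹` do not involve `t`, so `t → 1/t` fixes them.
  rw [hC, omegaT_C, map_inv₀, map_natCast]

/-- Since `ω_t` is semilinear over `t → 1/t`, it preserves any `K`-span of eigenvectors. -/
theorem omegaT_mem_lamK {k : ℕ} {f : Lam (Coeff F)} (hf : f ∈ lamK (t F) k) :
    omegaT F f ∈ lamK (t F) k := by
  rw [lamK_eq_map_schurSpan t_pow_succ_ne_one, schurSpan, Submodule.map_span] at hf ⊢
  induction hf using Submodule.span_induction with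
  | mem g hg =>
    obtain ⟨_, ⟨lam, hk, rfl⟩, rfl⟩ := hg
    rw [AlgHom.toLinearMap_apply, omegaT_plethysm_schur]
    exact Submodule.smul_mem _ _ (Submodule.subset_span ⟨_, ⟨lam, hk, rfl⟩, rfl⟩)
  | zero => rw [map_zero]; exact Submodule.zero_mem _
  | add g g' _ _ hg hg' => rw [map_add]; exact Submodule.add_mem _ hg hg'
  | smul a g _ hg => rw [omegaT_smul]; exact Submodule.smul_mem _ _ hg

end Twist

end SymmFun

end

theorem mainTheorem10 {F : Type*} [Field F] [CharZero F] :
    (∀ (k : ℕ) (f : SymmFun.Lam (SymmFun.Coeff F)),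
      f ∈ SymmFun.lamK (SymmFun.t F) k →
        SymmFun.omegaT F f ∈ SymmFun.lamK (SymmFun.t F) k) ∧
    (∀ lam : YoungDiagram,
      SymmFun.omegaT F (SymmFun.plethysm (SymmFun.t F) (SymmFun.schur (SymmFun.Coeff F) lam)) =
        (-SymmFun.t F) ^ lam.card •
          SymmFun.plethysm (SymmFun.t F) (SymmFun.schur (SymmFun.Coeff F) lam)) :=
  ⟨fun _ _ hf => SymmFun.omegaT_mem_lamK hf, SymmFun.omegaT_plethysm_schur⟩
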